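/- Let $X$ be a smooth closed connected oriented four-manifold with $b_2^+(X)=0$, and let $[X]\in H_4(X;\mathbb Z)$ be its fundamental class. Let $\{e_i\}$ be a finite set of classes in $H^2(X;\mathbb Z)$ which induce a basis of $H^2(X;\mathbb Z)/\mathrm{Tors}$ diagonalising the (unimodular) intersection form, i.e. $\langle e_i\cup e_j,[X]\rangle=0$ for $i\neq j$ and $\langle e_i\cup e_i,[X]\rangle=\pm1$ (hence $=-1$, since $b_2^+(X)=0$); by Donaldson's theorem such classes exist. Let $w\in H^2(X;\mathbb Z/2)$ be the reduction of $\sum_i e_i$ modulo $2$, and let $x_0\in X$. For a representation $\rho:\pi_1(X,x_0)\to SO(3)$ let $V_\rho=\widetilde X\times_\rho\mathbb R^3$ be the associated flat oriented rank-3 bundle over $X$, where $\widetilde X$ is the universal covering. Suppose that there is a representation $\rho$ with second Stiefel-Whitney class $w_2(V_\rho)=w$. Then for no $i$ is the Poincaré dual $PD(e_i)=[X]\cap e_i\in H_2(X;\mathbb Z)$ in the image of the Hurewicz homomorphism $h:\pi_2(X,x_0)\to H_2(X;\mathbb Z)$. -/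

import Mathlib

open scoped Topology

noncomputable section

namespace FlatSO3

/-! ### Singular chains and cochains -/

/-- A singular `n`-simplex of `X`: a continuous map from the standard `n`-simplex to `X`. -/
abbrev SingularSimplex (n : ℕ) (X : Type*) [TopologicalSpace X] : Type _ :=
  C(stdSimplex ℝ (Fin (n + 1)), X)

section Simplices

variable {X : Type*} [TopologicalSpace X] {m n k : ℕ}

/-- Precomposition of a singular simplex with the affine map of standard simplices which on
vertices is given by `f`. -/
def SingularSimplex.pull (σ : SingularSimplex n X) (f : Fin (m + 1) → Fin (n + 1)) :
    SingularSimplex m X :=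
  σ.comp ⟨stdSimplex.map f, stdSimplex.continuous_map f⟩

theorem SingularSimplex.pull_pull (σ : SingularSimplex n X) (f : Fin (m + 1) → Fin (n + 1))
    (g : Fin (k + 1) → Fin (m + 1)) : (σ.pull f).pull g = σ.pull (fun i => f (g i)) := by
  ext t
  exact congrArg σ (stdSimplex.map_comp_apply g f t)

/-- The `i`-th face of a singular simplex. -/
def SingularSimplex.face (i : Fin (n + 2)) (σ : SingularSimplex (n + 1) X) :
    SingularSimplex n X :=
  σ.pull i.succAbove

/-- The front `p`-face `σ|[v₀, …, v_p]`. -/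
def SingularSimplex.front (p q : ℕ) (σ : SingularSimplex (p + q) X) : SingularSimplex p X :=
  σ.pull (Fin.castLE (by omega))

/-- The back `q`-face `σ|[v_p, …, v_{p+q}]`. -/
def SingularSimplex.back (p q : ℕ) (σ : SingularSimplex (p + q) X) : SingularSimplex q X :=
  σ.pull (fun i : Fin (q + 1) => (Fin.natAdd p i : Fin (p + (q + 1))))

end Simplices

/-- Integral singular `n`-chains. -/
abbrev Chain (n : ℕ) (X : Type*) [TopologicalSpace X] : Type _ := SingularSimplex n X →₀ ℤ

/-- Singular `n`-cochains with coefficients in `R`. -/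
abbrev Cochain (n : ℕ) (X : Type*) [TopologicalSpace X] (R : Type*) : Type _ :=
  SingularSimplex n X → R

section Complexes

variable {X : Type*} [TopologicalSpace X] {R : Type*} [CommRing R] {n : ℕ}

/-- The singular boundary operator. -/
def boundary (n : ℕ) (X : Type*) [TopologicalSpace X] : Chain (n + 1) X →ₗ[ℤ] Chain n X :=
  Finsupp.linearCombination ℤ fun σ : SingularSimplex (n + 1) X =>
    ∑ i : Fin (n + 2), Finsupp.single (σ.face i) ((-1 : ℤ) ^ (i : ℕ))

/-- The singular coboundary operator, `(δφ)(σ) = φ(∂σ)`. -/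
def coboundary (n : ℕ) (X : Type*) [TopologicalSpace X] (R : Type*) [CommRing R] :
    Cochain n X R →ₗ[R] Cochain (n + 1) X R where
  toFun φ := fun σ => ∑ i : Fin (n + 2), (-1 : R) ^ (i : ℕ) * φ (σ.face i)
  map_add' φ ψ := by
    funext σ
    simp [mul_add, Finset.sum_add_distrib]
  map_smul' r φ := by
    funext σ
    simp only [Pi.smul_apply, smul_eq_mul, RingHom.id_apply, Finset.mul_sum]
    exact Finset.sum_congr rfl fun i _ => by ring

/-- Singular cycles (every `0`-chain is a cycle). -/
def cycles : (n : ℕ) → (X : Type*) → [TopologicalSpace X] → Submodule ℤ (Chain n X)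
  | 0, _, _ => ⊤
  | n + 1, X, _ => LinearMap.ker (boundary n X)

/-- Singular boundaries. -/
def boundaries (n : ℕ) (X : Type*) [TopologicalSpace X] : Submodule ℤ (Chain n X) :=
  LinearMap.range (boundary n X)

/-- Singular homology `H_n(X; ℤ)`. -/
abbrev Homology (n : ℕ) (X : Type*) [TopologicalSpace X] : Type _ :=
  cycles n X ⧸ (boundaries n X).submoduleOf (cycles n X)

/-- Singular cocycles. -/
def cocycles (n : ℕ) (X : Type*) [TopologicalSpace X] (R : Type*) [CommRing R] :
    Submodule R (Cochain n X R) :=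
  LinearMap.ker (coboundary n X R)

/-- Singular coboundaries (only zero in degree `0`). -/
def coboundaries : (n : ℕ) → (X : Type*) → [TopologicalSpace X] → (R : Type*) → [CommRing R] →
    Submodule R (Cochain n X R)
  | 0, _, _, _, _ => ⊥
  | n + 1, X, _, R, _ => LinearMap.range (coboundary n X R)

/-- Singular cohomology `H^n(X; R)`. -/
abbrev Cohomology (n : ℕ) (X : Type*) [TopologicalSpace X] (R : Type*) [CommRing R] : Type _ :=
  cocycles n X R ⧸ (coboundaries n X R).submoduleOf (cocycles n X R)

/-- Evaluation of a cochain with coefficients in `R` on an integral chain. -/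
def evalChain (φ : Cochain n X R) : Chain n X →ₗ[ℤ] R := Finsupp.linearCombination ℤ φ

theorem boundary_single (σ : SingularSimplex (n + 1) X) :
    boundary n X (Finsupp.single σ 1) =
      ∑ i : Fin (n + 2), Finsupp.single (σ.face i) ((-1 : ℤ) ^ (i : ℕ)) := by
  simp [boundary]

theorem evalChain_coboundary (φ : Cochain n X R) (c : Chain (n + 1) X) :
    evalChain (coboundary n X R φ) c = evalChain φ (boundary n X c) := by
  have h : evalChain (coboundary n X R φ) = (evalChain φ).comp (boundary n X) := by
    refine Finsupp.lhom_ext' fun σ => LinearMap.ext_ring ?_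
    simp [evalChain, boundary, coboundary]
  exact congrArg (fun f : Chain (n + 1) X →ₗ[ℤ] R => f c) h

/-- Evaluation as a pairing on the level of cocycles and homology classes. -/
def kroneckerAux (n : ℕ) (X : Type*) [TopologicalSpace X] (R : Type*) [CommRing R] :
    cocycles n X R →ₗ[R] Homology n X →ₗ[ℤ] R where
  toFun φ := Submodule.liftQ _ ((evalChain φ.1).domRestrict (cycles n X)) (by
    rintro ⟨c, hc⟩ ⟨b, hb⟩
    have hφ : coboundary n X R φ.1 = 0 := φ.2
    have hb' : boundary n X b = c := hb
    change evalChain φ.1 c = 0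
    rw [← hb', ← evalChain_coboundary, hφ]
    simp [evalChain])
  map_add' φ ψ := by
    refine Submodule.linearMap_qext _ (LinearMap.ext fun c => ?_)
    simp [evalChain, Finsupp.linearCombination_apply, Finsupp.sum_add]
  map_smul' r φ := by
    refine Submodule.linearMap_qext _ (LinearMap.ext fun c => ?_)
    simp [evalChain, Finsupp.linearCombination_apply, Finsupp.mul_sum, mul_left_comm]

/-- The Kronecker pairing `⟨·, ·⟩ : H^n(X; R) × H_n(X; ℤ) → R`. -/
def kronecker (n : ℕ) (X : Type*) [TopologicalSpace X] (R : Type*) [CommRing R] :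
    Cohomology n X R →ₗ[R] Homology n X →ₗ[ℤ] R :=
  Submodule.liftQ _ (kroneckerAux n X R) (by
    rintro ⟨φ, hφ⟩ hφ'
    refine Submodule.linearMap_qext _ (LinearMap.ext fun c => ?_)
    change evalChain φ c.1 = 0
    have h' : φ ∈ coboundaries n X R := hφ'
    obtain ⟨c, hc⟩ := c
    cases n with
    | zero =>
      have h0 : φ = 0 := h'
      simp [h0, evalChain]
    | succ n =>
      obtain ⟨α, rfl⟩ := h'
      have hc' : boundary n X c = 0 := hc
      change evalChain (coboundary n X R α) c = 0
      rw [evalChain_coboundary, hc', map_zero])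

/-- The change of coefficients `H^n(X; ℤ) → H^n(X; R)`. -/
def changeCoeff (n : ℕ) (X : Type*) [TopologicalSpace X] (R : Type*) [CommRing R] :
    Cohomology n X ℤ →ₗ[ℤ] Cohomology n X R :=
  Submodule.liftQ _
    (AddMonoidHom.toIntLinearMap
      { toFun := fun φ => Submodule.Quotient.mk ⟨fun σ => ((φ.1 σ : ℤ) : R), by
          have hφ : coboundary n X ℤ φ.1 = 0 := φ.2
          change coboundary n X R _ = 0
          funext σ
          have := congrArg (Int.cast : ℤ → R) (congrFun hφ σ)
          simpa [coboundary] using this⟩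
        map_zero' := by
          rw [Submodule.Quotient.mk_eq_zero]
          convert Submodule.zero_mem _
          simp
        map_add' := fun φ ψ => by
          rw [← Submodule.Quotient.mk_add]
          congr 1
          ext σ
          simp })
    (by
      rintro ⟨φ, hφ⟩ hφ'
      have h' : φ ∈ coboundaries n X ℤ := hφ'
      refine (Submodule.Quotient.mk_eq_zero _).2 ?_
      change (fun σ => ((φ σ : ℤ) : R)) ∈ coboundaries n X R
      cases n with
      | zero =>
        have h0 : φ = 0 := h'
        subst h0
        change _ = _
        funext σ
        simp
      | succ n =>
        obtain ⟨α, rfl⟩ := h'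
        refine ⟨fun σ => ((α σ : ℤ) : R), ?_⟩
        funext σ
        simp [coboundary])

end Complexes

/-! ### Cup and cap products -/

section Products

variable {X : Type*} [TopologicalSpace X] {R : Type*} [CommRing R]

/-- The cup product of singular cochains,
`(φ ∪ ψ)(σ) = φ(σ|[v₀, …, v_p]) ψ(σ|[v_p, …, v_{p+q}])`. -/
def cup (p q : ℕ) (φ : Cochain p X R) (ψ : Cochain q X R) : Cochain (p + q) X R :=
  fun σ => φ (SingularSimplex.front p q σ) * ψ (SingularSimplex.back p q σ)

/-- The cap product of a singular chain with a singular cochain,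
`σ ∩ φ = φ(σ|[v₀, …, v_p]) σ|[v_p, …, v_{p+q}]`. -/
def cap (p q : ℕ) (φ : Cochain p X ℤ) : Chain (p + q) X →ₗ[ℤ] Chain q X :=
  Finsupp.linearCombination ℤ fun σ : SingularSimplex (p + q) X =>
    Finsupp.single (SingularSimplex.back p q σ) (φ (SingularSimplex.front p q σ))

theorem evalChain_cap (p q : ℕ) (φ : Cochain p X ℤ) (ψ : Cochain q X ℤ) (c : Chain (p + q) X) :
    evalChain ψ (cap p q φ c) = evalChain (cup p q φ ψ) c := by
  have h : (evalChain ψ).comp (cap p q φ) = evalChain (cup p q φ ψ) := by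
    refine Finsupp.lhom_ext' fun σ => LinearMap.ext_ring ?_
    simp [evalChain, cap, cup]
  exact congrArg (fun f : Chain (p + q) X →ₗ[ℤ] ℤ => f c) h

theorem chain_ext {n : ℕ} {c d : Chain n X}
    (h : ∀ ψ : Cochain n X ℤ, evalChain ψ c = evalChain ψ d) : c = d := by
  classical
  ext σ
  have := h (Pi.single σ 1)
  simp only [evalChain, Finsupp.linearCombination_apply] at this
  rw [Finsupp.sum_eq_single σ (by intro τ _ h; simp [h]) (by simp),
    Finsupp.sum_eq_single σ (by intro τ _ h; simp [h]) (by simp)] at this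
  simpa using this

theorem pull_congr {m n : ℕ} (σ : SingularSimplex n X) {f g : Fin (m + 1) → Fin (n + 1)}
    (h : ∀ i, f i = g i) : σ.pull f = σ.pull g := by
  rw [funext h]

theorem coboundary_cup_two_two (φ : Cochain 2 X R) (ψ : Cochain 2 X R) :
    coboundary 4 X R (cup 2 2 φ ψ) =
      cup 3 2 (coboundary 2 X R φ) ψ + cup 2 3 φ (coboundary 2 X R ψ) := by
  funext σ
  have hf (j : Fin 6) (i : Fin 4) (h : (j : ℕ) = i) : SingularSimplex.front 2 2 (σ.face j) = (SingularSimplex.front 3 2 σ).face i := by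
    simp only [SingularSimplex.front, SingularSimplex.face, SingularSimplex.pull_pull]
    exact pull_congr σ (by revert h; revert j; revert i; decide)
  have hf' (j : Fin 6)  (h : 3 ≤ (j : ℕ)) : SingularSimplex.front 2 2 (σ.face j) = SingularSimplex.front 2 3 σ := by
    simp only [SingularSimplex.front, SingularSimplex.face, SingularSimplex.pull_pull]
    exact pull_congr σ (by revert h; revert j; decide)
  have hb (j : Fin 6)  (h : (j : ℕ) ≤ 2) : SingularSimplex.back 2 2 (σ.face j) = SingularSimplex.back 3 2 σ := by
    simp only [SingularSimplex.back, SingularSimplex.face, SingularSimplex.pull_pull]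
    exact pull_congr σ (by revert h; revert j; decide)
  have hb' (j : Fin 6) (i : Fin 4) (h : (j : ℕ) = 2 + i) : SingularSimplex.back 2 2 (σ.face j) = (SingularSimplex.back 2 3 σ).face i := by
    simp only [SingularSimplex.back, SingularSimplex.face, SingularSimplex.pull_pull]
    exact pull_congr σ (by revert h; revert j; revert i; decide)
  have hm : (SingularSimplex.front 3 2 σ).face 3 = SingularSimplex.front 2 3 σ := by
    rw [← hf 3 3 rfl, hf' 3 (by decide)]
  have hm' : (SingularSimplex.back 2 3 σ).face 0 = SingularSimplex.back 3 2 σ := by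
    rw [← hb' 2 0 rfl, hb 2 (by decide)]
  change (∑ i : Fin 6, (-1 : R) ^ (i : ℕ) * (φ (SingularSimplex.front 2 2 (σ.face i)) *
      ψ (SingularSimplex.back 2 2 (σ.face i)))) =
    (∑ i : Fin 4, (-1 : R) ^ (i : ℕ) * φ ((SingularSimplex.front 3 2 σ).face i)) *
      ψ (SingularSimplex.back 3 2 σ) + φ (SingularSimplex.front 2 3 σ) *
      ∑ i : Fin 4, (-1 : R) ^ (i : ℕ) * ψ ((SingularSimplex.back 2 3 σ).face i)
  simp only [Fin.sum_univ_four, Fin.sum_univ_six]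
  rw [hf 0 0 rfl, hf 1 1 rfl, hf 2 2 rfl, hf' 3 (by decide), hf' 4 (by decide), hf' 5 (by decide),
    hb 0 (by decide), hb 1 (by decide), hb 2 (by decide), hb' 3 1 rfl, hb' 4 2 rfl, hb' 5 3 rfl, hm, hm']
  norm_num
  ring

theorem coboundary_cup_one_two (φ : Cochain 1 X R) (ψ : Cochain 2 X R) :
    coboundary 3 X R (cup 1 2 φ ψ) =
      cup 2 2 (coboundary 1 X R φ) ψ - cup 1 3 φ (coboundary 2 X R ψ) := by
  funext σ
  have hf (j : Fin 5) (i : Fin 3) (h : (j : ℕ) = i) : SingularSimplex.front 1 2 (σ.face j) = (SingularSimplex.front 2 2 σ).face i := by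
    simp only [SingularSimplex.front, SingularSimplex.face, SingularSimplex.pull_pull]
    exact pull_congr σ (by revert h; revert j; revert i; decide)
  have hf' (j : Fin 5)  (h : 2 ≤ (j : ℕ)) : SingularSimplex.front 1 2 (σ.face j) = SingularSimplex.front 1 3 σ := by
    simp only [SingularSimplex.front, SingularSimplex.face, SingularSimplex.pull_pull]
    exact pull_congr σ (by revert h; revert j; decide)
  have hb (j : Fin 5)  (h : (j : ℕ) ≤ 1) : SingularSimplex.back 1 2 (σ.face j) = SingularSimplex.back 2 2 σ := by
    simp only [SingularSimplex.back, SingularSimplex.face, SingularSimplex.pull_pull]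
    exact pull_congr σ (by revert h; revert j; decide)
  have hb' (j : Fin 5) (i : Fin 4) (h : (j : ℕ) = 1 + i) : SingularSimplex.back 1 2 (σ.face j) = (SingularSimplex.back 1 3 σ).face i := by
    simp only [SingularSimplex.back, SingularSimplex.face, SingularSimplex.pull_pull]
    exact pull_congr σ (by revert h; revert j; revert i; decide)
  have hm : (SingularSimplex.front 2 2 σ).face 2 = SingularSimplex.front 1 3 σ := by
    rw [← hf 2 2 rfl, hf' 2 (by decide)]
  have hm' : (SingularSimplex.back 1 3 σ).face 0 = SingularSimplex.back 2 2 σ := by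
    rw [← hb' 1 0 rfl, hb 1 (by decide)]
  change (∑ i : Fin 5, (-1 : R) ^ (i : ℕ) * (φ (SingularSimplex.front 1 2 (σ.face i)) *
      ψ (SingularSimplex.back 1 2 (σ.face i)))) =
    (∑ i : Fin 3, (-1 : R) ^ (i : ℕ) * φ ((SingularSimplex.front 2 2 σ).face i)) *
      ψ (SingularSimplex.back 2 2 σ) - φ (SingularSimplex.front 1 3 σ) *
      ∑ i : Fin 4, (-1 : R) ^ (i : ℕ) * ψ ((SingularSimplex.back 1 3 σ).face i)
  simp only [Fin.sum_univ_three, Fin.sum_univ_four, Fin.sum_univ_five]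
  rw [hf 0 0 rfl, hf 1 1 rfl, hf' 2 (by decide), hf' 3 (by decide), hf' 4 (by decide),
    hb 0 (by decide), hb 1 (by decide), hb' 2 1 rfl, hb' 3 2 rfl, hb' 4 3 rfl, hm, hm']
  norm_num
  ring

theorem coboundary_cup_two_one (φ : Cochain 2 X R) (ψ : Cochain 1 X R) :
    coboundary 3 X R (cup 2 1 φ ψ) =
      cup 3 1 (coboundary 2 X R φ) ψ + cup 2 2 φ (coboundary 1 X R ψ) := by
  funext σ
  have hf (j : Fin 5) (i : Fin 4) (h : (j : ℕ) = i) : SingularSimplex.front 2 1 (σ.face j) = (SingularSimplex.front 3 1 σ).face i := by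
    simp only [SingularSimplex.front, SingularSimplex.face, SingularSimplex.pull_pull]
    exact pull_congr σ (by revert h; revert j; revert i; decide)
  have hf' (j : Fin 5)  (h : 3 ≤ (j : ℕ)) : SingularSimplex.front 2 1 (σ.face j) = SingularSimplex.front 2 2 σ := by
    simp only [SingularSimplex.front, SingularSimplex.face, SingularSimplex.pull_pull]
    exact pull_congr σ (by revert h; revert j; decide)
  have hb (j : Fin 5)  (h : (j : ℕ) ≤ 2) : SingularSimplex.back 2 1 (σ.face j) = SingularSimplex.back 3 1 σ := by
    simp only [SingularSimplex.back, SingularSimplex.face, SingularSimplex.pull_pull]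
    exact pull_congr σ (by revert h; revert j; decide)
  have hb' (j : Fin 5) (i : Fin 3) (h : (j : ℕ) = 2 + i) : SingularSimplex.back 2 1 (σ.face j) = (SingularSimplex.back 2 2 σ).face i := by
    simp only [SingularSimplex.back, SingularSimplex.face, SingularSimplex.pull_pull]
    exact pull_congr σ (by revert h; revert j; revert i; decide)
  have hm : (SingularSimplex.front 3 1 σ).face 3 = SingularSimplex.front 2 2 σ := by
    rw [← hf 3 3 rfl, hf' 3 (by decide)]
  have hm' : (SingularSimplex.back 2 2 σ).face 0 = SingularSimplex.back 3 1 σ := by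
    rw [← hb' 2 0 rfl, hb 2 (by decide)]
  change (∑ i : Fin 5, (-1 : R) ^ (i : ℕ) * (φ (SingularSimplex.front 2 1 (σ.face i)) *
      ψ (SingularSimplex.back 2 1 (σ.face i)))) =
    (∑ i : Fin 4, (-1 : R) ^ (i : ℕ) * φ ((SingularSimplex.front 3 1 σ).face i)) *
      ψ (SingularSimplex.back 3 1 σ) + φ (SingularSimplex.front 2 2 σ) *
      ∑ i : Fin 3, (-1 : R) ^ (i : ℕ) * ψ ((SingularSimplex.back 2 2 σ).face i)
  simp only [Fin.sum_univ_three, Fin.sum_univ_four, Fin.sum_univ_five]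
  rw [hf 0 0 rfl, hf 1 1 rfl, hf 2 2 rfl, hf' 3 (by decide), hf' 4 (by decide),
    hb 0 (by decide), hb 1 (by decide), hb 2 (by decide), hb' 3 1 rfl, hb' 4 2 rfl, hm, hm']
  norm_num
  ring

theorem cup_zero_left (p q : ℕ) (ψ : Cochain q X R) : cup p q 0 ψ = 0 := by
  funext σ
  simp [cup]

theorem cup_zero_right (p q : ℕ) (φ : Cochain p X R) : cup p q φ 0 = 0 := by
  funext σ
  simp [cup]

/-- The cup product of cocycles of degree `2`, as a cohomology class. -/
def cupAux (X : Type*) [TopologicalSpace X] (R : Type*) [CommRing R] :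
    cocycles 2 X R →ₗ[R] cocycles 2 X R →ₗ[R] Cohomology 4 X R :=
  LinearMap.mk₂ R
    (fun φ ψ => Submodule.Quotient.mk ⟨cup 2 2 φ.1 ψ.1, by
      have hφ : coboundary 2 X R φ.1 = 0 := φ.2
      have hψ : coboundary 2 X R ψ.1 = 0 := ψ.2
      change coboundary 4 X R _ = 0
      rw [coboundary_cup_two_two, hφ, hψ, cup_zero_left, cup_zero_right, add_zero]⟩)
    (fun φ φ' ψ => by
      rw [← Submodule.Quotient.mk_add]
      congr 1
      ext σ
      simp [cup, add_mul])
    (fun r φ ψ => by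
      rw [← Submodule.Quotient.mk_smul]
      congr 1
      ext σ
      simp [cup, mul_assoc])
    (fun φ ψ ψ' => by
      rw [← Submodule.Quotient.mk_add]
      congr 1
      ext σ
      simp [cup, mul_add])
    (fun r φ ψ => by
      rw [← Submodule.Quotient.mk_smul]
      congr 1
      ext σ
      simp [cup, mul_left_comm])

theorem cupAux_eq_zero_left (φ ψ : cocycles 2 X R) (h : φ.1 ∈ coboundaries 2 X R) :
    cupAux X R φ ψ = 0 := by
  obtain ⟨φ, hφ⟩ := φ
  obtain ⟨α, rfl⟩ := h
  have hψ : coboundary 2 X R ψ.1 = 0 := ψ.2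
  refine (Submodule.Quotient.mk_eq_zero _).2 ⟨cup 1 2 α ψ.1, ?_⟩
  rw [coboundary_cup_one_two, hψ, cup_zero_right, sub_zero]
  rfl

theorem cupAux_eq_zero_right (φ ψ : cocycles 2 X R) (h : ψ.1 ∈ coboundaries 2 X R) :
    cupAux X R φ ψ = 0 := by
  obtain ⟨ψ, hψ⟩ := ψ
  obtain ⟨β, rfl⟩ := h
  have hφ : coboundary 2 X R φ.1 = 0 := φ.2
  refine (Submodule.Quotient.mk_eq_zero _).2 ⟨cup 2 1 φ.1 β, ?_⟩
  rw [coboundary_cup_two_one, hφ, cup_zero_left, zero_add]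
  rfl

/-- The cup product `H²(X; R) × H²(X; R) → H⁴(X; R)`. -/
def cupProduct (X : Type*) [TopologicalSpace X] (R : Type*) [CommRing R] :
    Cohomology 2 X R →ₗ[R] Cohomology 2 X R →ₗ[R] Cohomology 4 X R :=
  Submodule.liftQ _
    { toFun := fun φ => Submodule.liftQ _ (cupAux X R φ) fun ψ hψ => cupAux_eq_zero_right φ ψ hψ
      map_add' := fun φ φ' => by
        refine Submodule.linearMap_qext _ (LinearMap.ext fun ψ => ?_)
        simp
        rfl
      map_smul' := fun r φ => by
        refine Submodule.linearMap_qext _ (LinearMap.ext fun ψ => ?_)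
        simp
        rfl }
    (fun φ hφ => by
      refine Submodule.linearMap_qext _ (LinearMap.ext fun ψ => ?_)
      exact cupAux_eq_zero_left φ ψ hφ)

theorem boundary_cap_cocycle (φ : Cochain 2 X ℤ) (hφ : coboundary 2 X ℤ φ = 0)
    (c : Chain 4 X) : boundary 1 X (cap 2 2 φ c) = cap 2 1 φ (boundary 3 X c) := by
  refine chain_ext fun ψ => ?_
  rw [← evalChain_coboundary, evalChain_cap, evalChain_cap, ← evalChain_coboundary,
    coboundary_cup_two_one, hφ, cup_zero_left, zero_add]

theorem cap_boundary_of_cocycle (φ : Cochain 2 X ℤ) (hφ : coboundary 2 X ℤ φ = 0)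
    (b : Chain 5 X) : cap 2 2 φ (boundary 4 X b) = boundary 2 X (cap 2 3 φ b) := by
  refine chain_ext fun ψ => ?_
  rw [← evalChain_coboundary, evalChain_cap, evalChain_cap, ← evalChain_coboundary,
    coboundary_cup_two_two, hφ, cup_zero_left, zero_add]

theorem cap_coboundary_of_cycle (α : Cochain 1 X ℤ) (c : Chain 4 X) (hc : boundary 3 X c = 0) :
    cap 2 2 (coboundary 1 X ℤ α) c = boundary 2 X (cap 1 3 α c) := by
  refine chain_ext fun ψ => ?_
  have h := evalChain_coboundary (cup 1 2 α ψ) c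
  rw [hc, map_zero, coboundary_cup_one_two] at h
  have h' : evalChain (cup 2 2 (coboundary 1 X ℤ α) ψ) c
      = evalChain (cup 1 3 α (coboundary 2 X ℤ ψ)) c := by
    rw [← sub_eq_zero, ← h]
    simp [evalChain, Finsupp.linearCombination_apply, Finsupp.sum, mul_sub]
  rw [← evalChain_coboundary, evalChain_cap, evalChain_cap, h']

/-- The cap product of a cycle of degree `4` with a cocycle of degree `2`, as a homology class. -/
def capAux (X : Type*) [TopologicalSpace X] :
    cocycles 2 X ℤ →ₗ[ℤ] cycles 4 X →ₗ[ℤ] Homology 2 X :=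
  LinearMap.mk₂ ℤ
    (fun φ c => Submodule.Quotient.mk ⟨cap 2 2 φ.1 c.1, by
      have hc : boundary 3 X c.1 = 0 := c.2
      change boundary 1 X _ = 0
      rw [boundary_cap_cocycle φ.1 φ.2, hc, map_zero]⟩)
    (fun φ φ' c => by
      rw [← Submodule.Quotient.mk_add]
      congr 1
      refine Subtype.ext (chain_ext fun ψ => ?_)
      change evalChain ψ (cap 2 2 (φ.1 + φ'.1) c.1) =
        evalChain ψ (cap 2 2 φ.1 c.1 + cap 2 2 φ'.1 c.1)
      rw [map_add, evalChain_cap, evalChain_cap, evalChain_cap]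
      simp [evalChain, cup, Finsupp.linearCombination_apply, Finsupp.sum, add_mul, mul_add,
        Finset.sum_add_distrib])
    (fun r φ c => by
      rw [← Submodule.Quotient.mk_smul]
      congr 1
      refine Subtype.ext (chain_ext fun ψ => ?_)
      change evalChain ψ (cap 2 2 (r • φ.1) c.1) = evalChain ψ (r • cap 2 2 φ.1 c.1)
      rw [map_smul, evalChain_cap, evalChain_cap]
      simp [evalChain, cup, Finsupp.linearCombination_apply, Finsupp.sum, Finset.mul_sum,
        mul_assoc, mul_left_comm])
    (fun φ c c' => by
      rw [← Submodule.Quotient.mk_add]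
      congr 1
      exact Subtype.ext (map_add (cap 2 2 φ.1) c.1 c'.1))
    (fun r φ c => by
      rw [← Submodule.Quotient.mk_smul]
      congr 1
      exact Subtype.ext (map_smul (cap 2 2 φ.1) r c.1))

/-- The cap product `H²(X; ℤ) × H₄(X; ℤ) → H₂(X; ℤ)`. -/
def capProduct (X : Type*) [TopologicalSpace X] :
    Cohomology 2 X ℤ →ₗ[ℤ] Homology 4 X →ₗ[ℤ] Homology 2 X :=
  Submodule.liftQ _
    { toFun := fun φ => Submodule.liftQ _ (capAux X φ) (by
        rintro ⟨c, hc⟩ ⟨b, hb⟩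
        have hb' : boundary 4 X b = c := hb
        subst hb'
        exact (Submodule.Quotient.mk_eq_zero _).2
          ⟨cap 2 3 φ.1 b, (cap_boundary_of_cocycle φ.1 φ.2 b).symm⟩)
      map_add' := fun φ φ' => by
        refine Submodule.linearMap_qext _ (LinearMap.ext fun ψ => ?_)
        simp
      map_smul' := fun r φ => by
        refine Submodule.linearMap_qext _ (LinearMap.ext fun ψ => ?_)
        simp }
    (by
      rintro ⟨φ, hφ⟩ ⟨α, hα⟩
      have hα' : coboundary 1 X ℤ α = φ := hα
      subst hα'
      refine Submodule.linearMap_qext _ (LinearMap.ext fun c => ?_)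
      exact (Submodule.Quotient.mk_eq_zero _).2
        ⟨cap 1 3 α c.1, (cap_coboundary_of_cycle α c.1 c.2).symm⟩)

end Products

/-! ### Orientations, Poincaré duals and the intersection form -/

section Orientation

variable {X : Type*} [TopologicalSpace X] {n : ℕ}

/-- The chains of `X` all of whose simplices lie in `A`. -/
def chainsIn (n : ℕ) (A : Set X) : Submodule ℤ (Chain n X) :=
  Finsupp.supported ℤ ℤ {σ : SingularSimplex n X | ∀ t, σ t ∈ A}

/-- Relative cycles: chains whose boundary lies in `A`. -/
def relCycles : (n : ℕ) → {X : Type*} → [TopologicalSpace X] → (A : Set X) →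
    Submodule ℤ (Chain n X)
  | 0, _, _, _ => ⊤
  | n + 1, X, _, A => (chainsIn n A).comap (boundary n X)

theorem cycles_le_relCycles (n : ℕ) (A : Set X) : cycles n X ≤ relCycles n A := by
  cases n with
  | zero => exact le_rfl
  | succ n =>
    intro c hc
    have hc' : boundary n X c = 0 := hc
    change boundary n X c ∈ chainsIn n A
    rw [hc']
    exact Submodule.zero_mem _

/-- Relative singular homology `H_n(X, A; ℤ)`: relative cycles modulo boundaries and chains
in `A`. -/
abbrev RelHomology (n : ℕ) (A : Set X) : Type _ :=
  relCycles n A ⧸ (boundaries n X ⊔ chainsIn n A).submoduleOf (relCycles n A)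

/-- The natural map `H_n(X; ℤ) → H_n(X, A; ℤ)`. -/
def toRel (n : ℕ) (A : Set X) : Homology n X →ₗ[ℤ] RelHomology n A :=
  Submodule.mapQ _ _ (Submodule.inclusion (cycles_le_relCycles n A)) (fun _ hc =>
    (le_sup_left : boundaries n X ≤ boundaries n X ⊔ chainsIn n A) hc)

/-- `μ` is a fundamental class of the closed `n`-manifold `X`, i.e. an orientation of `X`:
its image in `H_n(X, X ∖ {x}; ℤ) ≅ ℤ` is a generator for every `x`. -/
def IsFundamentalClass (μ : Homology n X) : Prop :=
  ∀ x : X, Submodule.span ℤ {toRel n {x}ᶜ μ} = ⊤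

/-- The Poincaré dual `PD(a) = [X] ∩ a` of a class `a ∈ H²(X; ℤ)`, for the fundamental class
`[X] = μ` of a `4`-manifold. -/
def poincareDual (μ : Homology 4 X) (a : Cohomology 2 X ℤ) : Homology 2 X :=
  capProduct X a μ

/-- The intersection form `a · b = ⟨a ∪ b, [X]⟩` on `H²(X; R)`, where `[X] = μ`. -/
def intersectionForm (μ : Homology 4 X) (R : Type*) [CommRing R] (a b : Cohomology 2 X R) : R :=
  kronecker 4 X R (cupProduct X R a b) μ

/-- `b₂⁺`: the maximal dimension of a subspace of `H²(X; ℝ)` on which the intersection form is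
positive definite. -/
def bTwoPlus (μ : Homology 4 X) : ℕ∞ :=
  ⨆ W : {W : Submodule ℝ (Cohomology 2 X ℝ) //
      ∀ a ∈ W, a ≠ 0 → 0 < intersectionForm μ ℝ a a},
    (Module.finrank ℝ W.1 : ℕ∞)

/-- The classes `e i ∈ H²(X; ℤ)` induce a basis of `H²(X; ℤ) / Tors` which diagonalises the
(unimodular) intersection form, in the sense of Donaldson's theorem: the matrix of the form in this
basis is diagonal with entries `±1`. (If `b₂⁺ = 0`, all of them are `-1`.) -/
structure IsDiagonalisingBasis (μ : Homology 4 X) {ι : Type*} (e : ι → Cohomology 2 X ℤ) :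
    Prop where
  basis : ∃ b : Module.Basis ι ℤ (Cohomology 2 X ℤ ⧸ Submodule.torsion ℤ (Cohomology 2 X ℤ)),
    ∀ i, b i = Submodule.Quotient.mk (e i)
  diagonal : ∀ i j, i ≠ j → intersectionForm μ ℤ (e i) (e j) = 0
  unit : ∀ i, IsUnit (intersectionForm μ ℤ (e i) (e i))

end Orientation

/-! ### The Hurewicz map -/

section Hurewicz

variable {X : Type*} [TopologicalSpace X] {x₀ : X}

theorem coord_add_mem (t : stdSimplex ℝ (Fin 3)) : t 1 + t 2 ∈ unitInterval := by
  have h := stdSimplex.sum_eq_one t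
  rw [Fin.sum_univ_three] at h
  have h0 := stdSimplex.zero_le t 0
  have h1 := stdSimplex.zero_le t 1
  have h2 := stdSimplex.zero_le t 2
  exact ⟨by linarith, by linarith⟩

theorem continuous_coord {n : ℕ} (i : Fin (n + 1)) :
    Continuous fun t : stdSimplex ℝ (Fin (n + 1)) => t i :=
  (continuous_apply i).comp continuous_subtype_val

/-- The coordinate `t₁ + t₂` on the standard `2`-simplex. -/
def coordSum : C(stdSimplex ℝ (Fin 3), unitInterval) where
  toFun t := ⟨t 1 + t 2, coord_add_mem t⟩
  continuous_toFun := ((continuous_coord 1).add (continuous_coord 2)).subtype_mk _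

/-- A barycentric coordinate, with values in the unit interval. -/
def coord {n : ℕ} (i : Fin (n + 1)) : C(stdSimplex ℝ (Fin (n + 1)), unitInterval) where
  toFun t := ⟨t i, stdSimplex.zero_le t i, stdSimplex.le_one t i⟩
  continuous_toFun := (continuous_coord i).subtype_mk _

/-- The affine triangle with vertices `(0,0)`, `(1,0)`, `(1,1)` in the unit square. -/
def lowerTriangle : C(stdSimplex ℝ (Fin 3), Fin 2 → unitInterval) :=
  ContinuousMap.pi ![coordSum, coord 2]

/-- The affine triangle with vertices `(0,0)`, `(0,1)`, `(1,1)` in the unit square. -/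
def upperTriangle : C(stdSimplex ℝ (Fin 3), Fin 2 → unitInterval) :=
  ContinuousMap.pi ![coord 2, coordSum]

theorem map_apply_eq_zero {m n : ℕ} (f : Fin (m + 1) → Fin (n + 1)) (v : Fin (n + 1))
    (h : ∀ i, f i ≠ v) (t : stdSimplex ℝ (Fin (m + 1))) : stdSimplex.map f t v = 0 := by
  classical
  rw [stdSimplex.map_coe, FunOnFinite.linearMap_apply_apply, Finset.filter_eq_empty_iff.2]
  · simp
  · intro i _
    exact h i

theorem triangles_edge (s : stdSimplex ℝ (Fin 3)) (v : Fin 3) (hv : s v = 0) :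
    lowerTriangle s = upperTriangle s ∨
      (lowerTriangle s ∈ Cube.boundary (Fin 2) ∧ upperTriangle s ∈ Cube.boundary (Fin 2)) := by
  have h := stdSimplex.sum_eq_one s
  rw [Fin.sum_univ_three] at h
  fin_cases v
  · have h1 : coordSum s = 1 := Subtype.ext (by
      change s 1 + s 2 = 1
      have hv' : s 0 = 0 := hv
      linarith)
    exact Or.inr ⟨⟨0, Or.inr h1⟩, ⟨1, Or.inr h1⟩⟩
  · have h1 : coordSum s = coord 2 s := Subtype.ext (by
      change s 1 + s 2 = s 2
      have hv' : s 1 = 0 := hv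
      linarith)
    refine Or.inl (funext fun i => ?_)
    fin_cases i
    · exact h1
    · exact h1.symm
  · have h1 : coord 2 s = 0 := Subtype.ext hv
    exact Or.inr ⟨⟨1, Or.inl h1⟩, ⟨0, Or.inl h1⟩⟩

theorem loop_triangle_face (f : GenLoop (Fin 2) X x₀) (i : Fin 3) :
    SingularSimplex.face i (f.1.comp lowerTriangle : SingularSimplex 2 X) =
      SingularSimplex.face i (f.1.comp upperTriangle : SingularSimplex 2 X) := by
  ext t
  change f.1 (lowerTriangle (stdSimplex.map i.succAbove t)) =
    f.1 (upperTriangle (stdSimplex.map i.succAbove t))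
  rcases triangles_edge (stdSimplex.map i.succAbove t) i
    (map_apply_eq_zero _ _ (Fin.succAbove_ne i) t) with h | ⟨h, h'⟩
  · rw [h]
  · exact (f.2 _ h).trans (f.2 _ h').symm

/-- The singular cycle `f_*[S²]`, for a map `f : (I², ∂I²) → (X, x₀)`, considered as a map from
the sphere `S² = I² / ∂I²`; its fundamental class is represented by the difference of the
two triangles into which the square is cut by its diagonal. -/
def sphereChain (f : GenLoop (Fin 2) X x₀) : Chain 2 X :=
  Finsupp.single (f.1.comp lowerTriangle : SingularSimplex 2 X) 1 -
    Finsupp.single (f.1.comp upperTriangle : SingularSimplex 2 X) 1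

theorem sphereChain_mem (f : GenLoop (Fin 2) X x₀) : sphereChain f ∈ cycles 2 X := by
  change boundary 1 X (_ - _) = 0
  rw [map_sub, boundary_single, boundary_single, sub_eq_zero]
  exact Finset.sum_congr rfl fun i _ => by rw [loop_triangle_face f i]

/-- The simplex `t ↦ F(a(t)₁, T(b(t)))` of a homotopy `F`, where `a` and `b` are extended affinely
from the vertices. -/
def prismSimplex (F : C(unitInterval × (Fin 2 → unitInterval), X))
    (T : C(stdSimplex ℝ (Fin 3), Fin 2 → unitInterval)) {n : ℕ}
    (a : Fin (n + 1) → Fin 2) (b : Fin (n + 1) → Fin 3) : SingularSimplex n X :=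
  F.comp (((coord (n := 1) 1).comp ⟨stdSimplex.map a, stdSimplex.continuous_map a⟩).prodMk
    (T.comp ⟨stdSimplex.map b, stdSimplex.continuous_map b⟩))

theorem prismSimplex_face (F : C(unitInterval × (Fin 2 → unitInterval), X))
    (T : C(stdSimplex ℝ (Fin 3), Fin 2 → unitInterval)) {n : ℕ}
    (a : Fin (n + 2) → Fin 2) (b : Fin (n + 2) → Fin 3) (i : Fin (n + 2)) :
    SingularSimplex.face i (prismSimplex F T a b : SingularSimplex (n + 1) X) =
      prismSimplex F T (fun k => a (i.succAbove k)) (fun k => b (i.succAbove k)) := by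
  ext t
  change F (coord (n := 1) 1 (stdSimplex.map a (stdSimplex.map i.succAbove t)),
      T (stdSimplex.map b (stdSimplex.map i.succAbove t))) = _
  rw [stdSimplex.map_comp_apply, stdSimplex.map_comp_apply]
  rfl

theorem prismSimplex_side {f g : GenLoop (Fin 2) X x₀}
    (F : ContinuousMap.HomotopyRel f.1 g.1 (Cube.boundary (Fin 2))) {n : ℕ}
    (a : Fin (n + 1) → Fin 2) (b : Fin (n + 1) → Fin 3) (v : Fin 3) (h : ∀ i, b i ≠ v) :
    prismSimplex F.toContinuousMap lowerTriangle a b =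
      prismSimplex F.toContinuousMap upperTriangle a b := by
  ext t
  change F (_, lowerTriangle (stdSimplex.map b t)) = F (_, upperTriangle (stdSimplex.map b t))
  rcases triangles_edge (stdSimplex.map b t) v (map_apply_eq_zero _ _ h t) with h | ⟨h, h'⟩
  · rw [h]
  · rw [F.eq_fst _ h, F.eq_fst _ h']
    exact (f.2 _ h).trans (f.2 _ h').symm

theorem prismSimplex_bottom {f g : GenLoop (Fin 2) X x₀}
    (F : ContinuousMap.HomotopyRel f.1 g.1 (Cube.boundary (Fin 2)))
    (T : C(stdSimplex ℝ (Fin 3), Fin 2 → unitInterval)) (a : Fin 3 → Fin 2)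
    (b : Fin 3 → Fin 3) (ha : ∀ i, a i = 0) (hb : ∀ i, b i = i) :
    prismSimplex (n := 2) F.toContinuousMap T a b = f.1.comp T := by
  obtain rfl : b = id := funext hb
  ext t
  have h : coord (n := 1) 1 (stdSimplex.map a t) = 0 :=
    Subtype.ext (map_apply_eq_zero a 1 (fun i => by rw [ha i]; decide) t)
  change F (coord (n := 1) 1 (stdSimplex.map a t), T (stdSimplex.map id t)) = f.1 (T t)
  rw [h, stdSimplex.map_id_apply]
  exact F.apply_zero _

theorem prismSimplex_top {f g : GenLoop (Fin 2) X x₀}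
    (F : ContinuousMap.HomotopyRel f.1 g.1 (Cube.boundary (Fin 2)))
    (T : C(stdSimplex ℝ (Fin 3), Fin 2 → unitInterval)) (a : Fin 3 → Fin 2)
    (b : Fin 3 → Fin 3) (ha : ∀ i, a i = 1) (hb : ∀ i, b i = i) :
    prismSimplex (n := 2) F.toContinuousMap T a b = g.1.comp T := by
  obtain rfl : b = id := funext hb
  ext t
  have h : coord (n := 1) 1 (stdSimplex.map a t) = 1 := Subtype.ext (by
    have h1 := stdSimplex.add_eq_one (stdSimplex.map a t)
    rw [map_apply_eq_zero (n := 1) a 0 (fun i => by rw [ha i]; decide) t, zero_add] at h1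
    exact h1)
  change F (coord (n := 1) 1 (stdSimplex.map a t), T (stdSimplex.map id t)) = g.1 (T t)
  rw [h, stdSimplex.map_id_apply]
  exact F.apply_one _

/-- The `j`-th simplex of the prism over the triangle `T`. -/
def prism (F : C(unitInterval × (Fin 2 → unitInterval), X))
    (T : C(stdSimplex ℝ (Fin 3), Fin 2 → unitInterval)) (j : Fin 3) : SingularSimplex 3 X :=
  prismSimplex (n := 3) F T (fun i => if (j : ℕ) < i then 1 else 0) (fun i => j.predAbove i)

theorem sphereChain_sub_mem {f g : GenLoop (Fin 2) X x₀} (h : GenLoop.Homotopic f g) :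
    sphereChain f - sphereChain g ∈ boundaries 2 X := by
  obtain ⟨F⟩ := h
  have e1 (T : C(stdSimplex ℝ (Fin 3), Fin 2 → unitInterval)) :
      (prism F.toContinuousMap T 0).face 1 = (prism F.toContinuousMap T 1).face 1 := by
    rw [prism, prism, prismSimplex_face, prismSimplex_face]
    congr 1 <;> decide
  have e2 (T : C(stdSimplex ℝ (Fin 3), Fin 2 → unitInterval)) :
      (prism F.toContinuousMap T 1).face 2 = (prism F.toContinuousMap T 2).face 2 := by
    rw [prism, prism, prismSimplex_face, prismSimplex_face]
    congr 1 <;> decide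
  have top (T : C(stdSimplex ℝ (Fin 3), Fin 2 → unitInterval)) :
      (prism F.toContinuousMap T 0).face 0 = g.1.comp T := by
    rw [prism, prismSimplex_face]
    exact prismSimplex_top F T _ _ (by decide) (by decide)
  have bot (T : C(stdSimplex ℝ (Fin 3), Fin 2 → unitInterval)) :
      (prism F.toContinuousMap T 2).face 3 = f.1.comp T := by
    rw [prism, prismSimplex_face]
    exact prismSimplex_bottom F T _ _ (by decide) (by decide)
  have side (j : Fin 3) (i : Fin 4) (v : Fin 3) (h : ∀ k, j.predAbove (i.succAbove k) ≠ v) :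
      (prism F.toContinuousMap lowerTriangle j).face i =
        (prism F.toContinuousMap upperTriangle j).face i := by
    rw [prism, prism, prismSimplex_face, prismSimplex_face]
    exact prismSimplex_side F _ _ v h
  refine ⟨∑ j : Fin 3, (-1 : ℤ) ^ (j : ℕ) •
    (Finsupp.single (prism F.toContinuousMap upperTriangle j) 1 -
      Finsupp.single (prism F.toContinuousMap lowerTriangle j) 1), ?_⟩
  simp only [map_sum, map_smul, map_sub, boundary_single]
  simp only [Fin.sum_univ_three]
  change (_ • ((∑ i : Fin 4, _) - ∑ i : Fin 4, _) + _ • ((∑ i : Fin 4, _) - ∑ i : Fin 4, _) +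
    _ • ((∑ i : Fin 4, _) - ∑ i : Fin 4, _) : Chain 2 X) = _
  simp only [Fin.sum_univ_four, e1, e2, top, bot, side 0 2 1 (by decide), side 0 3 2 (by decide),
    side 1 0 0 (by decide), side 1 3 2 (by decide), side 2 0 0 (by decide),
    side 2 1 1 (by decide), sphereChain]
  norm_num [Finsupp.single_neg]
  abel

/-- The Hurewicz map `π₂(X, x₀) → H₂(X; ℤ)`, `[f] ↦ f_*[S²]`. -/
def hurewicz (x₀ : X) : HomotopyGroup.Pi 2 X x₀ → Homology 2 X :=
  Quotient.lift (fun f : GenLoop (Fin 2) X x₀ =>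
      (Submodule.Quotient.mk ⟨sphereChain f, sphereChain_mem f⟩ : Homology 2 X))
    (fun _ _ h => (Submodule.Quotient.eq _).2 (sphereChain_sub_mem h))

end Hurewicz

/-! ### Flat `SO(3)`-bundles and their second Stiefel-Whitney class -/

section FlatBundles

variable {X : Type*} [TopologicalSpace X] {x₀ : X}

/-- The universal covering of `X` (for `X` connected and locally simply connected): homotopy
classes, relative to end points, of paths starting at `x₀`. -/
def UniversalCover (x₀ : X) : Type _ := Σ x : X, Path.Homotopic.Quotient x₀ x

/-- The topology generated by the sets `{[γ · η] : η a path in U starting at γ(1)}` with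
`U ⊆ X` open. -/
instance (x₀ : X) : TopologicalSpace (UniversalCover x₀) :=
  TopologicalSpace.generateFrom
    {W | ∃ (z : UniversalCover x₀) (U : Set X), IsOpen U ∧
      W = {y | ∃ η : Path z.1 y.1, (∀ t, η t ∈ U) ∧
        y.2 = z.2.trans (Path.Homotopic.Quotient.mk η)}}

/-- The action of `π₁(X, x₀)` on the universal covering by deck transformations,
`([γ], [α]) ↦ [α · γ]`. With the multiplication of Mathlib's fundamental group (where `p * q` is
the class of `q` followed by `p`) this is a right action. -/
def UniversalCover.deck (z : UniversalCover x₀) (g : FundamentalGroup X x₀) : UniversalCover x₀ :=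
  ⟨z.1, g.toPath.trans z.2⟩

theorem UniversalCover.deck_mul (z : UniversalCover x₀) (g h : FundamentalGroup X x₀) :
    z.deck (g * h) = (z.deck g).deck h := by
  let γ : FundamentalGroupoid.mk x₀ ⟶ FundamentalGroupoid.mk z.1 := z.2
  exact congrArg (Sigma.mk z.1) (CategoryTheory.Category.assoc h.toArrow g.toArrow γ)

/-- The bundle `V_ρ = X̃ ×_ρ ℝ³` associated with a representation `ρ : π₁(X, x₀) → SO(3)`: the
quotient of `X̃ × ℝ³` by `(z · g, v) ∼ (z, ρ(g) v)`, with the quotient topology. -/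
def FlatBundle (ρ : FundamentalGroup X x₀ →* Matrix.specialOrthogonalGroup (Fin 3) ℝ) : Type _ :=
  Quot fun a b : UniversalCover x₀ × (Fin 3 → ℝ) =>
    ∃ g : FundamentalGroup X x₀, a.1 = b.1.deck g ∧ b.2 = (ρ g).1.mulVec a.2

variable (ρ : FundamentalGroup X x₀ →* Matrix.specialOrthogonalGroup (Fin 3) ℝ)

instance : TopologicalSpace (FlatBundle ρ) :=
  inferInstanceAs (TopologicalSpace (Quot _))

/-- The bundle projection `V_ρ → X`. -/
def FlatBundle.proj : FlatBundle ρ → X :=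
  Quot.lift (fun a => a.1.1) (by
    rintro ⟨_, v⟩ ⟨z, w⟩ ⟨g, rfl, _⟩
    rfl)

/-- The total space of the bundle of oriented orthonormal frames of `V_ρ`: triples of elements
of one fibre of `V_ρ` which, in the coordinates `v ↦ [z, v]` given by some point `z` of `X̃` over
the base point, are the columns of a matrix in `SO(3)`. -/
def OrientedFrame : Type _ :=
  {F : Fin 3 → FlatBundle ρ // ∃ (z : UniversalCover x₀)
    (A : Matrix.specialOrthogonalGroup (Fin 3) ℝ), ∀ i, F i = Quot.mk _ (z, fun j => A.1 j i)}

instance : TopologicalSpace (OrientedFrame ρ) :=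
  inferInstanceAs (TopologicalSpace {_F : Fin 3 → FlatBundle ρ // _})

/-- The projection of the frame bundle to `X`. -/
def OrientedFrame.proj (F : OrientedFrame ρ) : X := FlatBundle.proj ρ (F.1 0)

/-- `c` is the obstruction cochain for extending a section of `π : P → X` over the `1`-skeleton
to the `2`-skeleton (of the singular set of `X`), where `P → X` is a bundle with connected fibre
with fundamental group of order two: lifts `s₀`, `s₁` of all singular `0`- and `1`-simplices are
chosen compatibly, and `c(τ) = 0` if and only if the lift on the boundary of the singular
`2`-simplex `τ` extends to a lift of `τ`. -/
def IsObstructionCochain {P : Type*} [TopologicalSpace P] (π : P → X)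
    (c : Cochain 2 X (ZMod 2)) : Prop :=
  ∃ (s₀ : SingularSimplex 0 X → SingularSimplex 0 P)
    (s₁ : SingularSimplex 1 X → SingularSimplex 1 P),
    (∀ σ t, π (s₀ σ t) = σ t) ∧
    (∀ σ t, π (s₁ σ t) = σ t) ∧
    (∀ (σ : SingularSimplex 1 X) (i : Fin 2),
      SingularSimplex.face i (s₁ σ) = s₀ (SingularSimplex.face i σ)) ∧
    ∀ τ : SingularSimplex 2 X, c τ = 0 ↔
      ∃ T : SingularSimplex 2 P, (∀ t, π (T t) = τ t) ∧
        ∀ i : Fin 3, SingularSimplex.face i T = s₁ (SingularSimplex.face i τ)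

/-- `w ∈ H²(X; ℤ/2)` is the second Stiefel-Whitney class of `V_ρ`: the primary obstruction to a
section of the bundle of oriented orthonormal frames of `V_ρ`, with coefficients in
`π₁(SO(3)) = ℤ/2`. -/
def HasStiefelWhitneyClass (w : Cohomology 2 X (ZMod 2)) : Prop :=
  ∃ c : cocycles 2 X (ZMod 2), Submodule.Quotient.mk c = w ∧
    IsObstructionCochain (OrientedFrame.proj ρ) c.1

end FlatBundles

end FlatSO3

end

open scoped Manifold ContDiff

noncomputable section

namespace FlatSO3

/-! ### The Kronecker pairing, change of coefficients and the cap product -/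

section Pairings

variable {X : Type*} [TopologicalSpace X]

/-! Evaluate `w` on `PD(e_i)` in two ways. Cap-cup adjunction gives `⟨∑ e_j, PD(e_i)⟩ = ∑ e_i · e_j
= e_i · e_i = ±1`, so `w` takes the value `1` in `ZMod 2` (`kronecker_sum_poincareDual`). If
`PD(e_i)` were spherical the value would be `0` (`kronecker_hurewicz_eq_zero`): a flat bundle pulled
back to the simply connected sphere is trivial, so its second Stiefel-Whitney class vanishes there.

The second fact is proved directly on cochains. The cycle of a spherical map is the difference of
two triangles with the same faces. A `ZMod 2`-valued obstruction cochain is determined by where it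
vanishes, so it suffices that the lift prescribed on the common boundary extends over one triangle
if and only if it extends over the other.

To see this, lift the square to the universal covering; its whole boundary goes to one point
(`continuous_liftCube`, `liftCube_boundary`). Relative to such a lift, a frame over the first
triangle becomes a matrix-valued function, continuous by `FlatBundle.continuous_coordinate`. The
same matrices, read relative to the lift of the second triangle, give a frame over that triangle
(`OrientedFrame.exists_transport`). On the edges the two lifts to the covering coincide, hence so do
the frames. -/

theorem kronecker_changeCoeff {R : Type*} [CommRing R] (n : ℕ) (a : Cohomology n X ℤ)
    (z : Homology n X) :
    kronecker n X R (changeCoeff n X R a) z = ((kronecker n X ℤ a z : ℤ) : R) := by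
  obtain ⟨φ, rfl⟩ := Submodule.Quotient.mk_surjective _ a
  obtain ⟨c, rfl⟩ := Submodule.Quotient.mk_surjective _ z
  change evalChain (fun σ => ((φ.1 σ : ℤ) : R)) c.1 = ((evalChain φ.1 c.1 : ℤ) : R)
  simp [evalChain, Finsupp.linearCombination_apply, Finsupp.sum]

/-- This is the cap-cup adjunction, which already holds on chains by `evalChain_cap`. -/
theorem kronecker_poincareDual (μ : Homology 4 X) (a b : Cohomology 2 X ℤ) :
    kronecker 2 X ℤ b (poincareDual μ a) = intersectionForm μ ℤ a b := by
  obtain ⟨φ, rfl⟩ := Submodule.Quotient.mk_surjective _ a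
  obtain ⟨ψ, rfl⟩ := Submodule.Quotient.mk_surjective _ b
  obtain ⟨c, rfl⟩ := Submodule.Quotient.mk_surjective _ μ
  exact evalChain_cap 2 2 φ.1 ψ.1 c.1

theorem kronecker_sum_poincareDual {μ : Homology 4 X} {ι : Type*} [Fintype ι]
    {e : ι → Cohomology 2 X ℤ} (he : IsDiagonalisingBasis μ e) (i : ι) :
    kronecker 2 X (ZMod 2) (changeCoeff 2 X (ZMod 2) (∑ j, e j)) (poincareDual μ (e i)) = 1 := by
  rw [kronecker_changeCoeff, map_sum, LinearMap.sum_apply]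
  simp only [kronecker_poincareDual]
  rw [Finset.sum_eq_single i (fun j _ hj => he.diagonal i j hj.symm) (by simp)]
  -- Both `1` and `-1` reduce to `1` modulo 2, so the sign of the diagonal entry plays no role.
  rcases Int.isUnit_iff.1 (he.unit i) with h | h <;> rw [h] <;> decide

end Pairings

/-! ### The action of the fundamental group on the universal covering -/

namespace UniversalCover

variable {X : Type*} [TopologicalSpace X] {x₀ : X}

theorem deck_one (z : UniversalCover x₀) : z.deck 1 = z :=
  congrArg (Sigma.mk z.1) (Path.Homotopic.Quotient.refl_trans z.2)

theorem deck_inv_deck (z : UniversalCover x₀) (g : FundamentalGroup X x₀) :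
    (z.deck g⁻¹).deck g = z := by
  rw [← deck_mul, inv_mul_cancel, deck_one]

theorem deck_deck_inv (z : UniversalCover x₀) (g : FundamentalGroup X x₀) :
    (z.deck g).deck g⁻¹ = z := by
  rw [← deck_mul, mul_inv_cancel, deck_one]

/-- The deck action is free: compose with the inverse of the path class of `z` to cancel it. -/
theorem eq_one_of_deck_eq {z : UniversalCover x₀} {g : FundamentalGroup X x₀}
    (h : z.deck g = z) : g = 1 := by
  obtain ⟨x, γ⟩ := z
  have h' : Path.Homotopic.Quotient.trans g.toPath γ = γ := eq_of_heq (Sigma.mk.inj h).2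
  have := congrArg (fun α => Path.Homotopic.Quotient.trans α γ.symm) h'
  simp only [Path.Homotopic.Quotient.trans_assoc, Path.Homotopic.Quotient.trans_symm,
    Path.Homotopic.Quotient.trans_refl] at this
  exact this

/-- The deck action is transitive on fibres: the required loop runs out along `z` and back along
`w`. -/
theorem exists_deck_eq {z w : UniversalCover x₀} (h : z.1 = w.1) :
    ∃ g : FundamentalGroup X x₀, z = w.deck g := by
  obtain ⟨x, γ⟩ := z
  obtain ⟨y, δ⟩ := w
  obtain rfl : x = y := h
  refine ⟨FundamentalGroup.fromPath (γ.trans δ.symm), congrArg (Sigma.mk x) ?_⟩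
  change γ = (γ.trans δ.symm).trans δ
  rw [Path.Homotopic.Quotient.trans_assoc, Path.Homotopic.Quotient.symm_trans,
    Path.Homotopic.Quotient.trans_refl]

/-- The basic open set of all `[γ · η]`, where `z = [γ]` and `η` is a path in `U` starting
at `γ(1)`. -/
def sheet (z : UniversalCover x₀) (U : Set X) : Set (UniversalCover x₀) :=
  {y | ∃ η : Path z.1 y.1, (∀ t, η t ∈ U) ∧ y.2 = z.2.trans (Path.Homotopic.Quotient.mk η)}

theorem isOpen_sheet (z : UniversalCover x₀) {U : Set X} (hU : IsOpen U) : IsOpen (z.sheet U) :=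
  TopologicalSpace.isOpen_generateFrom_of_mem ⟨z, U, hU, rfl⟩

theorem mem_sheet_self (z : UniversalCover x₀) {U : Set X} (hz : z.1 ∈ U) : z ∈ z.sheet U :=
  ⟨Path.refl _, fun _ => hz, (Path.Homotopic.Quotient.trans_refl z.2).symm⟩

/-- Deck transformations change the beginning of a path, sheets its end, so the two commute by
associativity. -/
theorem deck_mem_sheet {z y : UniversalCover x₀} {U : Set X} (g : FundamentalGroup X x₀)
    (h : y ∈ z.sheet U) : y.deck g ∈ (z.deck g).sheet U := by
  obtain ⟨η, hη, hy⟩ := h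
  exact ⟨η, hη, (congrArg (Path.Homotopic.Quotient.trans g.toPath) hy).trans
    (Path.Homotopic.Quotient.trans_assoc _ _ _).symm⟩

theorem continuous_deck (g : FundamentalGroup X x₀) :
    Continuous fun z : UniversalCover x₀ => z.deck g := by
  refine continuous_generateFrom_iff.2 ?_
  rintro _ ⟨z, U, hU, rfl⟩
  -- The preimage of a sheet under a deck transformation is the sheet around the translated centre.
  convert isOpen_sheet (z.deck g⁻¹) hU using 1
  ext y
  constructor
  · intro h
    have := deck_mem_sheet g⁻¹ (show y.deck g ∈ z.sheet U from h)
    rwa [deck_deck_inv] at this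
  · intro h
    have := deck_mem_sheet g h
    rwa [deck_inv_deck] at this

/-- If paths in `U` with the same end points are homotopic in `X`, then the projection is injective
on the sheets over `U`. -/
theorem eq_of_mem_sheet {U : Set X}
    (hU : ∀ (a b : X) (p q : Path a b), (∀ t, p t ∈ U) → (∀ t, q t ∈ U) → p.Homotopic q)
    {z y w : UniversalCover x₀} (hy : y ∈ z.sheet U) (hw : w ∈ z.sheet U) (h : y.1 = w.1) :
    y = w := by
  obtain ⟨y, γ⟩ := y
  obtain ⟨w, δ⟩ := w
  obtain rfl : y = w := h
  obtain ⟨p, hp, hp'⟩ := hy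
  obtain ⟨q, hq, hq'⟩ := hw
  refine congrArg (Sigma.mk y) ?_
  change γ = z.2.trans _ at hp'
  change δ = z.2.trans _ at hq'
  rw [hp', hq', Path.Homotopic.Quotient.eq.2 (hU _ _ p q hp hq)]

end UniversalCover

/-- Every point of a manifold has an open neighbourhood in which paths with the same end points are
homotopic. -/
theorem exists_isOpen_paths_homotopic {E X : Type*} [NormedAddCommGroup E] [NormedSpace ℝ E]
    [TopologicalSpace X] [ChartedSpace E X] (x : X) :
    ∃ U : Set X, IsOpen U ∧ x ∈ U ∧
      ∀ (a b : X) (p q : Path a b), (∀ t, p t ∈ U) → (∀ t, q t ∈ U) → p.Homotopic q := by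
  let c := chartAt E x
  have hx : x ∈ c.source := mem_chart_source E x
  -- A ball inside the chart target corresponds to a contractible open set of `X`; paths in it are
  -- homotopic there, and the homotopy is then pushed forward to `X`.
  obtain ⟨r, hr, hB⟩ := Metric.isOpen_iff.1 c.open_target (c x) (c.map_source hx)
  let U : Set X := c.symm '' Metric.ball (c x) r
  refine ⟨U, c.isOpen_image_symm_of_subset_target Metric.isOpen_ball hB,
    ⟨c x, Metric.mem_ball_self hr, c.left_inv hx⟩, ?_⟩
  intro a b p q hp hq
  have := Metric.contractibleSpace_ball (x := c x) hr
  have : ContractibleSpace U :=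
    (c.symm.homeomorphOfImageSubsetSource hB rfl).symm.contractibleSpace
  have ha : a ∈ U := by simpa using hp 0
  have hb : b ∈ U := by simpa using hp 1
  let lift (s : Path a b) (hs : ∀ t, s t ∈ U) : Path (⟨a, ha⟩ : U) ⟨b, hb⟩ :=
    { toFun := fun t => ⟨s t, hs t⟩
      continuous_toFun := s.continuous.subtype_mk _
      source' := Subtype.ext s.source
      target' := Subtype.ext s.target }
  exact (SimplyConnectedSpace.paths_homotopic (lift p hp) (lift q hq)).map
    ⟨Subtype.val, continuous_subtype_val⟩

/-! ### Local structure of the flat bundle -/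

namespace FlatBundle

variable {X : Type*} [TopologicalSpace X] {x₀ : X}
  (ρ : FundamentalGroup X x₀ →* Matrix.specialOrthogonalGroup (Fin 3) ℝ)

/-- The quotient map `X̃ × ℝ³ → V_ρ`. -/
def mk (a : UniversalCover x₀ × (Fin 3 → ℝ)) : FlatBundle ρ := Quot.mk _ a

theorem continuous_mk : Continuous (mk ρ) := continuous_quot_mk

theorem mk_deck (z : UniversalCover x₀) (g : FundamentalGroup X x₀) (v : Fin 3 → ℝ) :
    mk ρ (z.deck g, v) = mk ρ (z, (ρ g).1.mulVec v) :=
  Quot.sound ⟨g, rfl, rfl⟩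

/-- Equality in a `Quot` is the equivalence relation generated by the given one. Here the given
relation is already an equivalence, since it comes from a group action. -/
theorem mk_eq_mk_iff {a b : UniversalCover x₀ × (Fin 3 → ℝ)} :
    mk ρ a = mk ρ b ↔
      ∃ g : FundamentalGroup X x₀, a.1 = b.1.deck g ∧ b.2 = (ρ g).1.mulVec a.2 := by
  refine ⟨fun h => ?_, fun h => Quot.sound h⟩
  refine (Equivalence.eqvGen_iff ⟨fun a => ⟨1, ?_, ?_⟩, @fun a b => ?_, @fun a b c => ?_⟩).1
    (Quot.eqvGen_exact h)
  · rintro ⟨g, h, h'⟩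
    refine ⟨g⁻¹, ?_, ?_⟩
    · rw [h, UniversalCover.deck_deck_inv]
    · rw [h', Matrix.mulVec_mulVec]
      have : (ρ g⁻¹).1 * (ρ g).1 = 1 := by
        rw [← Submonoid.coe_mul, ← map_mul, inv_mul_cancel, map_one, Submonoid.coe_one]
      rw [this, Matrix.one_mulVec]
  · rintro ⟨g, h, h'⟩ ⟨k, hk, hk'⟩
    refine ⟨k * g, ?_, ?_⟩
    · rw [h, hk, UniversalCover.deck_mul]
    · rw [hk', h', Matrix.mulVec_mulVec, map_mul, Submonoid.coe_mul]
  · rw [UniversalCover.deck_one]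
  · rw [map_one, Submonoid.coe_one, Matrix.one_mulVec]

/-- As for any quotient by a group acting by continuous maps, the saturation of an open set is the
union of its preimages under the diagonal action. -/
theorem isOpenMap_mk : IsOpenMap (mk ρ) := by
  intro N hN
  have h : mk ρ ⁻¹' (mk ρ '' N) = ⋃ g : FundamentalGroup X x₀,
      (fun a : UniversalCover x₀ × (Fin 3 → ℝ) => (a.1.deck g, (ρ g⁻¹).1.mulVec a.2)) ⁻¹' N := by
    ext b
    simp only [Set.mem_preimage, Set.mem_image, Set.mem_iUnion]
    constructor
    · rintro ⟨a, ha, hab⟩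
      obtain ⟨g, h, h'⟩ := (mk_eq_mk_iff ρ).1 hab
      refine ⟨g, ?_⟩
      rw [h', Matrix.mulVec_mulVec, ← Submonoid.coe_mul, ← map_mul, inv_mul_cancel, map_one,
        Submonoid.coe_one, Matrix.one_mulVec, ← h]
      exact ha
    · rintro ⟨g, hg⟩
      refine ⟨_, hg, ?_⟩
      rw [mk_deck, Matrix.mulVec_mulVec, ← Submonoid.coe_mul, ← map_mul, mul_inv_cancel, map_one,
        Submonoid.coe_one, Matrix.one_mulVec]
  change IsOpen (mk ρ ⁻¹' (mk ρ '' N))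
  rw [h]
  refine isOpen_iUnion fun g => hN.preimage ?_
  exact ((UniversalCover.continuous_deck g).comp continuous_fst).prodMk
    ((continuous_const (y := (ρ g⁻¹).1)).matrix_mulVec continuous_snd)

/-- The fibre coordinate of a continuous map to `V_ρ` with respect to a continuous lift of its
projection to the universal covering is continuous. -/
theorem continuous_coordinate {S : Type*} [TopologicalSpace S]
    (hX : ∀ x : X, ∃ U : Set X, IsOpen U ∧ x ∈ U ∧
      ∀ (a b : X) (p q : Path a b), (∀ t, p t ∈ U) → (∀ t, q t ∈ U) → p.Homotopic q)
    {G : S → UniversalCover x₀} (hG : Continuous G) {v : S → Fin 3 → ℝ}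
    (h : Continuous fun s => mk ρ (G s, v s)) : Continuous v := by
  refine continuous_iff_continuousAt.2 fun s => ?_
  obtain ⟨U, hUo, hsU, hU⟩ := hX (G s).1
  have hW := UniversalCover.isOpen_sheet (G s) hUo
  refine tendsto_nhds.2 fun N hN hsN => ?_
  -- The image of sheet times `N` is an open neighbourhood of the value at `s`. For `s'` near `s`
  -- the value is thus represented by some `(y, w)` with `w ∈ N`. Injectivity of the projection on
  -- the sheet gives `y = G s'`, freeness gives `g = 1`, and hence `v s' = w`.
  have h1 := h.continuousAt.preimage_mem_nhds (((isOpenMap_mk ρ) _ (hW.prod hN)).mem_nhds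
    ⟨(G s, v s), ⟨UniversalCover.mem_sheet_self _ hsU, hsN⟩, rfl⟩)
  have h2 := hG.continuousAt.preimage_mem_nhds (hW.mem_nhds (UniversalCover.mem_sheet_self _ hsU))
  filter_upwards [h1, h2] with s' hs' hs''
  obtain ⟨⟨y, w⟩, ⟨hy, hw⟩, hyw⟩ := hs'
  obtain ⟨g, hg, hg'⟩ := (mk_eq_mk_iff ρ).1 hyw
  have hb := congrArg (fun z : UniversalCover x₀ => z.1) hg
  have hy' : y = G s' := UniversalCover.eq_of_mem_sheet hU hy hs'' hb
  obtain rfl : g = 1 := UniversalCover.eq_one_of_deck_eq (hg.symm.trans hy')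
  rw [map_one, Submonoid.coe_one, Matrix.one_mulVec] at hg'
  change v s' ∈ N
  rw [show v s' = w from hg']
  exact hw

end FlatBundle

namespace OrientedFrame

variable {X : Type*} [TopologicalSpace X] {x₀ : X}
  (ρ : FundamentalGroup X x₀ →* Matrix.specialOrthogonalGroup (Fin 3) ℝ)

/-- The frame `[z, A]`. -/
def ofMatrix (z : UniversalCover x₀) (A : Matrix.specialOrthogonalGroup (Fin 3) ℝ) :
    OrientedFrame ρ :=
  ⟨fun i => FlatBundle.mk ρ (z, fun j => A.1 j i), z, A, fun _ => rfl⟩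

/-- Any point of the covering in the right fibre can serve as reference: moving to it by a deck
transformation `g` multiplies the matrix by `ρ g`, which stays in `SO(3)`. -/
theorem exists_eq_ofMatrix (F : OrientedFrame ρ) {z : UniversalCover x₀} (h : proj ρ F = z.1) :
    ∃ A, F = ofMatrix ρ z A := by
  obtain ⟨F, w, A, hF⟩ := F
  obtain rfl : F = fun i => FlatBundle.mk ρ (w, fun j => A.1 j i) := funext hF
  obtain ⟨g, rfl⟩ := UniversalCover.exists_deck_eq (show w.1 = z.1 from h)
  refine ⟨ρ g * A, Subtype.ext (funext fun i => ?_)⟩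
  exact FlatBundle.mk_deck ρ z g _

/-- A lift of a map to the frame bundle, along a map which lifts to the universal covering, can be
moved to any other map which lifts to the universal covering. -/
theorem exists_transport {S : Type*} [TopologicalSpace S]
    (hX : ∀ x : X, ∃ U : Set X, IsOpen U ∧ x ∈ U ∧
      ∀ (a b : X) (p q : Path a b), (∀ t, p t ∈ U) → (∀ t, q t ∈ U) → p.Homotopic q)
    {G H : S → UniversalCover x₀} (hG : Continuous G) (hH : Continuous H)
    (T : C(S, OrientedFrame ρ)) (hT : ∀ s, proj ρ (T s) = (G s).1) :
    ∃ T' : C(S, OrientedFrame ρ), (∀ s, proj ρ (T' s) = (H s).1) ∧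
      ∀ s, G s = H s → T' s = T s := by
  choose A hA using fun s => exists_eq_ofMatrix ρ (T s) (hT s)
  -- The matrices were chosen pointwise, so continuity has to be recovered, one column at a time.
  have hc (i : Fin 3) : Continuous fun s => fun j => (A s).1 j i := by
    refine FlatBundle.continuous_coordinate ρ hX hG ?_
    have : Continuous fun s => (T s).1 i :=
      (continuous_apply i).comp (continuous_subtype_val.comp T.continuous)
    simp only [hA] at this
    exact this
  refine ⟨⟨fun s => ofMatrix ρ (H s) (A s), Continuous.subtype_mk (continuous_pi fun i =>
    (FlatBundle.continuous_mk ρ).comp (hH.prodMk (hc i))) _⟩, fun s => rfl, fun s hs => ?_⟩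
  change ofMatrix ρ (H s) (A s) = T s
  rw [hA s, hs]

end OrientedFrame

/-! ### Paths in the unit square -/

section Square

theorem path_trans_mem {Y : Type*} [TopologicalSpace Y] {a b c : Y} {p : Path a b} {q : Path b c}
    {U : Set Y} (hp : ∀ t, p t ∈ U) (hq : ∀ t, q t ∈ U) (t : unitInterval) : p.trans q t ∈ U := by
  have ht : p.trans q t ∈ Set.range (p.trans q) := ⟨t, rfl⟩
  rw [Path.trans_range] at ht
  rcases ht with ⟨s, hs⟩ | ⟨s, hs⟩
  · exact hs ▸ hp s
  · exact hs ▸ hq s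

/-- The straight path between two points of a cube. -/
def cubeSegment {ι : Type*} (a b : ι → unitInterval) : Path a b where
  toFun s i := ⟨(1 - s) * a i + s * b i, convex_Icc (0 : ℝ) 1 (a i).2 (b i).2
    (sub_nonneg.2 s.2.2) s.2.1 (sub_add_cancel _ _)⟩
  continuous_toFun := by
    refine continuous_pi fun i => Continuous.subtype_mk ?_ _
    fun_prop
  source' := by
    funext i
    exact Subtype.ext (by simp)
  target' := by
    funext i
    exact Subtype.ext (by simp)

theorem cubeSegment_apply {ι : Type*} (a b : ι → unitInterval) (s : unitInterval) (i : ι) :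
    (cubeSegment a b s i : ℝ) = (1 - s) * a i + s * b i := rfl

theorem cubeSegment_eq_of_eq {ι : Type*} {a b : ι → unitInterval} {i : ι} (h : a i = b i)
    (s : unitInterval) : cubeSegment a b s i = a i := by
  refine Subtype.ext ?_
  rw [cubeSegment_apply, ← h]
  ring

theorem dist_cubeSegment_le {ι : Type*} [Fintype ι] (a b : ι → unitInterval) (s : unitInterval) :
    dist (cubeSegment a b s) a ≤ dist b a := by
  refine (dist_pi_le_iff dist_nonneg).2 fun i => le_trans ?_ (dist_le_pi_dist b a i)
  rw [Subtype.dist_eq, Subtype.dist_eq, Real.dist_eq, Real.dist_eq, cubeSegment_apply,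
    show (1 - s : ℝ) * a i + s * b i - a i = s * (b i - a i) by ring, abs_mul,
    abs_of_nonneg s.2.1]
  exact mul_le_of_le_one_left (abs_nonneg _) s.2.2

/-- A path class in a product is determined by its projections, and each factor is contractible. -/
theorem cube_paths_homotopic {ι : Type*} {a b : ι → unitInterval} (p q : Path a b) :
    p.Homotopic q := by
  have : ContractibleSpace unitInterval := (convex_Icc (0 : ℝ) 1).contractibleSpace ⟨0, by simp⟩
  rw [← Path.Homotopic.Quotient.eq, ← Path.Homotopic.pi_proj (Path.Homotopic.Quotient.mk p),
    ← Path.Homotopic.pi_proj (Path.Homotopic.Quotient.mk q)]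
  exact congrArg _ (funext fun i => Subsingleton.elim _ _)

end Square

/-! ### Lifting maps of cubes to the universal covering -/

section Lift

variable {X : Type*} [TopologicalSpace X] {x₀ : X} {ι : Type*}

/-- The lift of the end point of a path in a cube to the universal covering. -/
def liftPath (f : C(ι → unitInterval, X)) {a b : ι → unitInterval} (h : f a = x₀)
    (p : Path a b) : UniversalCover x₀ :=
  ⟨f b, Path.Homotopic.Quotient.mk ((p.map f.continuous).cast h.symm rfl)⟩

theorem liftPath_congr (f : C(ι → unitInterval, X)) {a b : ι → unitInterval} (h : f a = x₀)
    (p q : Path a b) : liftPath f h p = liftPath f h q :=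
  congrArg (Sigma.mk (f b)) (Path.Homotopic.Quotient.eq.2
    (((cube_paths_homotopic p q).map f).pathCast h.symm rfl))

theorem liftPath_trans (f : C(ι → unitInterval, X)) {a b c : ι → unitInterval} (h : f a = x₀)
    (p : Path a b) (q : Path b c) :
    liftPath f h (p.trans q) = ⟨f c, (liftPath f h p).2.trans
      (Path.Homotopic.Quotient.mk (q.map f.continuous))⟩ := by
  subst h
  refine congrArg (Sigma.mk (f c)) ?_
  rw [Path.map_trans]
  rfl

/-- The lift of a map of a cube to the universal covering. -/
def liftCube (f : C(ι → unitInterval, X)) {a : ι → unitInterval} (h : f a = x₀)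
    (b : ι → unitInterval) : UniversalCover x₀ :=
  liftPath f h (cubeSegment a b)

/-- If the lift at `b` lies in a sheet over `U`, then for `c` near `b` the segment from `b` to `c`
maps into `U`, and appending its image keeps the lift in the sheet. -/
theorem continuous_liftCube [Fintype ι] (f : C(ι → unitInterval, X)) {a : ι → unitInterval}
    (h : f a = x₀) : Continuous (liftCube f h) := by
  refine continuous_generateFrom_iff.2 ?_
  rintro _ ⟨z, U, hU, rfl⟩
  refine Metric.isOpen_iff.2 fun b hb => ?_
  obtain ⟨η, hη, hb⟩ := hb
  have hbU : (liftCube f h b).1 ∈ U := η.target ▸ hη 1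
  obtain ⟨r, hr, hB⟩ := Metric.isOpen_iff.1 (hU.preimage f.continuous) b hbU
  refine ⟨r, hr, fun c hc => ?_⟩
  have hseg (t : unitInterval) : f (cubeSegment b c t) ∈ U :=
    hB ((dist_cubeSegment_le b c t).trans_lt hc)
  refine ⟨η.trans ((cubeSegment b c).map f.continuous), path_trans_mem hη hseg, ?_⟩
  -- Path independence replaces the straight segment to `c` by the detour through `b`.
  have h1 := liftPath_congr f h (cubeSegment a c) ((cubeSegment a b).trans (cubeSegment b c))
  rw [liftPath_trans] at h1
  have h2 := eq_of_heq (Sigma.mk.inj h1).2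
  refine h2.trans ?_
  refine (congrArg (fun α => Path.Homotopic.Quotient.trans α (Path.Homotopic.Quotient.mk
    ((cubeSegment b c).map f.continuous))) hb).trans ?_
  exact Path.Homotopic.Quotient.trans_assoc _ _ _

theorem liftPath_eq_of_const (f : C(ι → unitInterval, X)) {a b : ι → unitInterval} (h : f a = x₀)
    (p : Path a b) (hp : ∀ t, f (p t) = x₀) :
    liftPath f h p = ⟨x₀, Path.Homotopic.Quotient.refl x₀⟩ := by
  -- The end point is generalised to a variable `y`, so that it can be identified with `x₀` in the
  -- dependent pair.
  have key (y : X) (q : Path x₀ y) (hq : ∀ t, q t = x₀) :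
      (⟨y, Path.Homotopic.Quotient.mk q⟩ : UniversalCover x₀) =
        ⟨x₀, Path.Homotopic.Quotient.refl x₀⟩ := by
    obtain rfl : y = x₀ := q.target.symm.trans (hq 1)
    obtain rfl : q = Path.refl y := Path.ext (funext hq)
    rfl
  exact key _ _ hp

theorem genLoop_zero (f : GenLoop (Fin 2) X x₀) : f.1 0 = x₀ := f.2 0 ⟨0, Or.inl rfl⟩

/-- Each boundary point can be reached from the origin inside the boundary, where `f` is constant;
the lift does not depend on the path used. -/
theorem liftCube_boundary (f : GenLoop (Fin 2) X x₀) {b : Fin 2 → unitInterval}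
    (hb : b ∈ Cube.boundary (Fin 2)) :
    liftCube f.1 (genLoop_zero f) b = ⟨x₀, Path.Homotopic.Quotient.refl x₀⟩ := by
  obtain ⟨k, hk | hk⟩ := hb
  -- The straight segment from the origin stays in the side where coordinate `k` is `0`.
  · exact liftPath_eq_of_const _ _ _ fun t => f.2 _
      ⟨k, Or.inl (cubeSegment_eq_of_eq (a := 0) hk.symm t)⟩
  -- The segment may cross the interior, so the path turns at the corner `c`: the first leg lies in
  -- the side where coordinate `l` is `0`, the second in the side where coordinate `k` is `1`.
  · let c : Fin 2 → unitInterval := Pi.single k 1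
    obtain ⟨l, hl⟩ := exists_ne k
    refine (liftPath_congr f.1 _ _ ((cubeSegment 0 c).trans (cubeSegment c b))).trans
      (liftPath_eq_of_const _ _ _ fun t => f.2 _
        (path_trans_mem (U := Cube.boundary (Fin 2)) (fun s => ⟨l, Or.inl ?_⟩)
          (fun s => ⟨k, Or.inr ?_⟩) t))
    · have hc : c l = 0 := Pi.single_eq_of_ne (M := fun _ => unitInterval) hl 1
      exact cubeSegment_eq_of_eq (a := 0) hc.symm s
    · have hc : c k = 1 := Pi.single_eq_same k 1
      exact (cubeSegment_eq_of_eq (hc.trans hk.symm) s).trans hc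

end Lift

/-! ### The second Stiefel-Whitney class of a flat bundle on spherical classes -/

section Spherical

variable {X : Type*} [TopologicalSpace X] {x₀ : X}
  (ρ : FundamentalGroup X x₀ →* Matrix.specialOrthogonalGroup (Fin 3) ℝ)

/-- Lifts to the frame bundle can be moved between two singular triangles of a spherical map which
agree along the edges, without changing the lift of the edges. -/
theorem exists_lift_of_lift
    (hX : ∀ x : X, ∃ U : Set X, IsOpen U ∧ x ∈ U ∧
      ∀ (a b : X) (p q : Path a b), (∀ t, p t ∈ U) → (∀ t, q t ∈ U) → p.Homotopic q)
    (f : GenLoop (Fin 2) X x₀) {D D' : C(stdSimplex ℝ (Fin 3), Fin 2 → unitInterval)}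
    (hD : ∀ (s : stdSimplex ℝ (Fin 3)) (v : Fin 3), s v = 0 → D s = D' s ∨
      (D s ∈ Cube.boundary (Fin 2) ∧ D' s ∈ Cube.boundary (Fin 2)))
    (T : SingularSimplex 2 (OrientedFrame ρ)) (hT : ∀ t, OrientedFrame.proj ρ (T t) = f.1 (D t)) :
    ∃ T' : SingularSimplex 2 (OrientedFrame ρ),
      (∀ t, OrientedFrame.proj ρ (T' t) = f.1 (D' t)) ∧
        ∀ i : Fin 3, SingularSimplex.face i T' = SingularSimplex.face i T := by
  have hg := continuous_liftCube f.1 (genLoop_zero f)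
  obtain ⟨T', hT', h⟩ := OrientedFrame.exists_transport ρ hX
    (hg.comp D.continuous) (hg.comp D'.continuous) T hT
  refine ⟨T', hT', fun i => ContinuousMap.ext fun t => h _ ?_⟩
  change liftCube f.1 (genLoop_zero f) (D (stdSimplex.map i.succAbove t)) =
    liftCube f.1 (genLoop_zero f) (D' (stdSimplex.map i.succAbove t))
  -- On an edge, either the two triangles have the same point in the square, or both points lie on
  -- its boundary, where the lift is constant.
  rcases hD (stdSimplex.map i.succAbove t) i
    (map_apply_eq_zero _ _ (Fin.succAbove_ne i) t) with h | ⟨h, h'⟩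
  · rw [h]
  · rw [liftCube_boundary f h, liftCube_boundary f h']

/-- The second Stiefel-Whitney class of a flat bundle vanishes on spherical classes. -/
theorem kronecker_hurewicz_eq_zero
    (hX : ∀ x : X, ∃ U : Set X, IsOpen U ∧ x ∈ U ∧
      ∀ (a b : X) (p q : Path a b), (∀ t, p t ∈ U) → (∀ t, q t ∈ U) → p.Homotopic q)
    {w : Cohomology 2 X (ZMod 2)} (hw : HasStiefelWhitneyClass ρ w)
    (α : HomotopyGroup.Pi 2 X x₀) : kronecker 2 X (ZMod 2) w (hurewicz x₀ α) = 0 := by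
  obtain ⟨c, rfl, s₀, s₁, -, -, -, hc⟩ := hw
  obtain ⟨f, rfl⟩ := Quotient.mk_surjective α
  change evalChain c.1 (sphereChain f) = 0
  have hface := loop_triangle_face f
  -- Both triangles have the same faces, so `s₁` prescribes the same lift on their boundaries, and
  -- an extension over one can be transported to the other.
  have hiff : c.1 (f.1.comp lowerTriangle) = 0 ↔ c.1 (f.1.comp upperTriangle) = 0 := by
    rw [hc, hc]
    constructor
    · rintro ⟨T, hT, hT'⟩
      obtain ⟨T', h, h'⟩ := exists_lift_of_lift ρ hX f triangles_edge T hT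
      exact ⟨T', h, fun i => by rw [h', hT', hface]⟩
    · rintro ⟨T, hT, hT'⟩
      obtain ⟨T', h, h'⟩ := exists_lift_of_lift ρ hX f (D' := lowerTriangle)
        (fun s v hv => (triangles_edge s v hv).imp Eq.symm And.symm) T hT
      exact ⟨T', h, fun i => by rw [h', hT', hface]⟩
  -- This is where coefficients of order two matter: an element is determined by whether it
  -- vanishes.
  have hmod : ∀ a b : ZMod 2, (a = 0 ↔ b = 0) → a - b = 0 := by decide
  rw [sphereChain, map_sub]
  simpa [evalChain] using hmod _ _ hiff

end Spherical

end FlatSO3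

end

theorem mainTheorem4 {X : Type*} [TopologicalSpace X] [T2Space X] [CompactSpace X]
    [ConnectedSpace X] [ChartedSpace (EuclideanSpace ℝ (Fin 4)) X] [IsManifold (𝓡 4) ∞ X]
    (μ : FlatSO3.Homology 4 X) (hμ : FlatSO3.IsFundamentalClass μ)
    (hb : FlatSO3.bTwoPlus μ = 0)
    {ι : Type*} [Fintype ι] (e : ι → FlatSO3.Cohomology 2 X ℤ)
    (he : FlatSO3.IsDiagonalisingBasis μ e) (x₀ : X)
    (hρ : ∃ ρ : FundamentalGroup X x₀ →* Matrix.specialOrthogonalGroup (Fin 3) ℝ,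
      FlatSO3.HasStiefelWhitneyClass ρ (FlatSO3.changeCoeff 2 X (ZMod 2) (∑ i, e i))) :
    ∀ i, FlatSO3.poincareDual μ (e i) ∉ Set.range (FlatSO3.hurewicz x₀) := by
  rintro i ⟨α, hα⟩
  obtain ⟨ρ, hρ⟩ := hρ
  have h0 := FlatSO3.kronecker_hurewicz_eq_zero ρ
    (FlatSO3.exists_isOpen_paths_homotopic (E := EuclideanSpace ℝ (Fin 4))) hρ α
  rw [hα, FlatSO3.kronecker_sum_poincareDual he i] at h0
  exact one_ne_zero h0
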